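/- Let $F_2=\langle a,b\rangle$ be the free group on two generators, write $\overline{x}=x^{-1}$, let $L_2=\{a,b,\overline a,\overline b\}$, and let $|w|$ be the length of the reduced word of $w\in F_2$. Write $w\sim v$ if $\phi(w)=v$ for some $\phi\in\operatorname{Aut}F_2$; the equivalence classes of $\sim$ are called automorphic conjugacy classes. A word $w$ is *minimal* if $|\phi(w)|\ge|w|$ for all $\phi\in\operatorname{Aut}F_2$. For words $u,w$ with $u$ nonempty, let $(u)_w$ be the number of occurrences of $u$ and $u^{-1}$ as contiguous subwords of $w$ read cyclically, counted by starting position in $w$ (and $(u)_w=0$ if $|u|>|w|$). A cyclically reduced word $w$ is a *root word* if $|(ab)_w-(a\overline b)_w|=(aa)_w=(bb)_w$. An automorphic conjugacy class is a *non-root class* if it contains no root word. Let $J\le\operatorname{Aut}F_2$ be the subgroup generated by the inner automorphisms and the automorphisms that permute $L_2$, and let $[w]$ be the class of $w$ under the action of $J$. A *one-letter automorphism* is an automorphism with $x\mapsto x$, $y\mapsto yx$ for some $x,y\in L_2$ with $y\notin\{x,\overline x\}$. The directed multigraph $\Gamma(W)$ of an automorphic conjugacy class $W$ has as vertices the classes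 $[w]$ of the minimal words $w\in W$, and the number of edges from $[w]$ to $[v]$ is the number of classes $[\phi]$, modulo $\operatorname{Inn}F_2$, of one-letter automorphisms $\phi$ with $\phi(w)\in[v]$ (this does not depend on the representatives). A directed multigraph is *of type (P3)* if, for some $m\ge1$, it is isomorphic to the graph with vertices $1,\dots,m$ which, for $m\ge2$, has exactly one edge from $i$ to $i+1$ for $1\le i<m$, one edge from $i+1$ to $i$ for $1\le i<m-1$, two edges from $m$ to $m-1$, and no others, and which for $m=1$ is a single vertex with two loops. **Corollary.** Let $W$ be a non-root automorphic conjugacy class that contains a minimal word of odd length and is such that $\Gamma(W)$ is of type (P3). Then $\Gamma(W)$ is the degenerate graph of type (P3): it has exactly one vertex, and that vertex has exactly two loops. -/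

import Mathlib

namespace AutConj

/-- The free group on two generators `a` and `b`. -/
abbrev F2 : Type := FreeGroup (Fin 2)

def a : F2 := FreeGroup.of 0

def b : F2 := FreeGroup.of 1

/-- The set of letters `{a, b, a⁻¹, b⁻¹}`. -/
def letters : Set F2 := {a, b, a⁻¹, b⁻¹}

/-- `w ∼ v`: some automorphism of `F2` maps `w` to `v`. -/
def AutEquiv (w v : F2) : Prop := ∃ φ : MulAut F2, φ w = v

/-- `W` is an automorphic conjugacy class, that is, an equivalence class of `∼`. -/
def IsAutClass (W : Set F2) : Prop := ∃ w : F2, W = {v | AutEquiv w v}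

/-- `w` is minimal: no automorphism shortens it (`FreeGroup.norm` is the length of the
reduced word). -/
def IsMinimal (w : F2) : Prop := ∀ φ : MulAut F2, w.norm ≤ (φ w).norm

/-- `(u)_w`: the number of occurrences of `u` and of `u⁻¹` as contiguous subwords of the
cyclic word `w`, counted by their starting positions in `w`. It is `0` if `u` is longer
than `w`. -/
def subwordCount (u w : F2) : ℕ :=
  ((Finset.range w.toWord.length).filter fun i =>
    (w.toWord.rotate i).take u.toWord.length = u.toWord ∨
    (w.toWord.rotate i).take u.toWord.length = u⁻¹.toWord).card

/-- `w` is a root word: it is cyclically reduced and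
`|(ab)_w - (ab⁻¹)_w| = (aa)_w = (bb)_w`. -/
def IsRootWord (w : F2) : Prop :=
  FreeGroup.IsCyclicallyReduced w.toWord ∧
  |(subwordCount (a * b) w : ℤ) - (subwordCount (a * b⁻¹) w : ℤ)| =
    (subwordCount (a * a) w : ℤ) ∧
  subwordCount (a * a) w = subwordCount (b * b) w

/-- A class is a root class if it contains a root word. -/
def IsRootClass (W : Set F2) : Prop := ∃ w ∈ W, IsRootWord w

/-- A permutation (Type I automorphism): an automorphism that permutes the letters. -/
def IsPermutation (φ : MulAut F2) : Prop := φ '' letters = letters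

/-- `φ` is the one-letter automorphism `({y}, x)` for some letters `x`, `y` with
`y ≠ x, x⁻¹`: it fixes `x` and maps `y` to `y x`. -/
def IsOneLetter (φ : MulAut F2) : Prop :=
  ∃ x ∈ letters, ∃ y ∈ letters, y ≠ x ∧ y ≠ x⁻¹ ∧ φ x = x ∧ φ y = y * x

/-- The group of inner automorphisms of `F2`. -/
def Inn : Subgroup (MulAut F2) := (MulAut.conj : F2 →* MulAut F2).range

/-- The subgroup generated by inner automorphisms and permutations. -/
def J : Subgroup (MulAut F2) := Subgroup.closure ((Inn : Set (MulAut F2)) ∪ {φ | IsPermutation φ})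

/-- `w ∼_J v`: some element of `J` maps `w` to `v`. -/
def JEquiv (w v : F2) : Prop := ∃ g ∈ J, g w = v

theorem JEquiv.refl (w : F2) : JEquiv w w := ⟨1, J.one_mem, rfl⟩

theorem JEquiv.symm {w v : F2} : JEquiv w v → JEquiv v w := by
  rintro ⟨g, hg, rfl⟩
  exact ⟨g⁻¹, J.inv_mem hg, by simp⟩

theorem JEquiv.trans {w v u : F2} : JEquiv w v → JEquiv v u → JEquiv w u := by
  rintro ⟨g, hg, rfl⟩ ⟨h, hh, rfl⟩
  exact ⟨h * g, J.mul_mem hh hg, rfl⟩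

instance innNormal : Inn.Normal where
  conj_mem := by
    rintro _ ⟨u, rfl⟩ g
    refine ⟨g u, ?_⟩
    ext v
    simp [MulAut.mul_apply]

/-- The classes `[φ]` modulo `Inn` of one-letter automorphisms `φ` with `φ(w) ∼_J v`. -/
def edgeSet (w v : F2) : Set (MulAut F2 ⧸ Inn) :=
  {c | ∃ φ : MulAut F2, IsOneLetter φ ∧ (φ : MulAut F2 ⧸ Inn) = c ∧ JEquiv (φ w) v}

theorem IsOneLetter.conj_perm {φ π : MulAut F2} (hφ : IsOneLetter φ) (hπ : IsPermutation π) :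
    IsOneLetter (π * φ * π⁻¹) := by
  obtain ⟨x, hx, y, hy, h1, h2, h3, h4⟩ := hφ
  refine ⟨π x, hπ ▸ Set.mem_image_of_mem _ hx, π y, hπ ▸ Set.mem_image_of_mem _ hy, ?_, ?_, ?_, ?_⟩
  · simpa using h1
  · exact fun h => h2 (π.injective (by rw [h, map_inv]))
  · simp [MulAut.mul_apply, h3]
  · simp [MulAut.mul_apply, h4]

theorem IsPermutation.inv {π : MulAut F2} (hπ : IsPermutation π) : IsPermutation π⁻¹ := by
  unfold IsPermutation
  conv_lhs => rw [← hπ, Set.image_image]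
  simp

theorem IsOneLetter.conj_J {g : MulAut F2} (hg : g ∈ J) :
    ∀ φ : MulAut F2, IsOneLetter φ →
      ∃ ψ : MulAut F2, IsOneLetter ψ ∧
        (ψ : MulAut F2 ⧸ Inn) = (g : MulAut F2 ⧸ Inn) * φ * (g : MulAut F2 ⧸ Inn)⁻¹ := by
  have key : ∀ g ∈ ((Inn : Set (MulAut F2)) ∪ {φ | IsPermutation φ}),
      ∀ φ : MulAut F2, IsOneLetter φ → ∃ ψ : MulAut F2, IsOneLetter ψ ∧
        (ψ : MulAut F2 ⧸ Inn) = (g : MulAut F2 ⧸ Inn) * φ * (g : MulAut F2 ⧸ Inn)⁻¹ := by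
    rintro g (hg | hg) φ hφ
    · refine ⟨φ, hφ, ?_⟩
      rw [(QuotientGroup.eq_one_iff g).2 hg]
      simp
    · exact ⟨_, hφ.conj_perm hg, by simp⟩
  have hinv : ∀ g ∈ ((Inn : Set (MulAut F2)) ∪ {φ | IsPermutation φ}),
      g⁻¹ ∈ ((Inn : Set (MulAut F2)) ∪ {φ | IsPermutation φ}) := by
    rintro g (hg | hg)
    · exact Or.inl (Inn.inv_mem hg)
    · exact Or.inr hg.inv
  unfold J at hg
  induction hg using Subgroup.closure_induction'' with
  | mem g hg => exact key g hg
  | inv_mem g hg => exact key g⁻¹ (hinv g hg)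
  | one => exact fun φ hφ => ⟨φ, hφ, by simp⟩
  | mul g h _ _ ihg ihh =>
    intro φ hφ
    obtain ⟨ψ, hψ, e⟩ := ihh φ hφ
    obtain ⟨χ, hχ, e'⟩ := ihg ψ hψ
    exact ⟨χ, hχ, by rw [e', e]; simp [mul_assoc]⟩

theorem edgeSet_conj {w v w' v' : F2} {g : MulAut F2} (hg : g ∈ J) (hw : g w = w')
    (hv : JEquiv v v') {c : MulAut F2 ⧸ Inn} (hc : c ∈ edgeSet w v) :
    (g : MulAut F2 ⧸ Inn) * c * (g : MulAut F2 ⧸ Inn)⁻¹ ∈ edgeSet w' v' := by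
  obtain ⟨φ, hφ, rfl, hφv⟩ := hc
  obtain ⟨ψ, hψ, e⟩ := hφ.conj_J hg
  refine ⟨ψ, hψ, e, ?_⟩
  have e2 : ((g * φ * g⁻¹ * ψ⁻¹ : MulAut F2) : MulAut F2 ⧸ Inn) = 1 := by
    simp [e]
  have hn := (QuotientGroup.eq_one_iff _).1 e2
  have hm : g * φ * g⁻¹ * ψ⁻¹ ∈ J := Subgroup.subset_closure (Or.inl hn)
  have h1 : JEquiv (ψ w') (g (φ w)) := ⟨_, hm, by simp [← hw, MulAut.mul_apply]⟩
  have h2 : JEquiv (φ w) (g (φ w)) := ⟨g, hg, rfl⟩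
  exact h1.trans (h2.symm.trans (hφv.trans hv))

theorem edgeSet_ncard_eq {w v w' v' : F2} (hw : JEquiv w w') (hv : JEquiv v v') :
    (edgeSet w v).ncard = (edgeSet w' v').ncard := by
  obtain ⟨g, hg, hgw⟩ := hw
  have h : edgeSet w' v' = (MulAut.conj (g : MulAut F2 ⧸ Inn)) '' edgeSet w v := by
    ext c
    constructor
    · intro hc
      refine ⟨_, edgeSet_conj (J.inv_mem hg) (by simp [← hgw]) hv.symm hc, ?_⟩
      simp [mul_assoc]
    · rintro ⟨d, hd, rfl⟩
      exact edgeSet_conj hg hgw hv hd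
  rw [h, Set.ncard_image_of_injective _ (MulAut.conj (g : MulAut F2 ⧸ Inn)).injective]

/-- The minimal words in `W`, with the relation `∼_J`. -/
def minimalSetoid (W : Set F2) : Setoid {w : F2 // w ∈ W ∧ IsMinimal w} where
  r w v := JEquiv w v
  iseqv := ⟨fun w => JEquiv.refl w, JEquiv.symm, JEquiv.trans⟩

/-- A directed multigraph, with loops allowed: `edges p q` is the number of edges from `p`
to `q`. -/
structure MultiDigraph where
  V : Type
  edges : V → V → ℕ

/-- The graph `Γ(W)`: its vertices are the minimal words in `W` modulo `∼_J`, and the number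
of edges from `[w]` to `[v]` is the number of classes `[φ]` modulo `Inn` of one-letter
automorphisms with `φ(w) ∈ [v]`. -/
noncomputable def Γ (W : Set F2) : MultiDigraph where
  V := Quotient (minimalSetoid W)
  edges := Quotient.lift₂ (fun w v => (edgeSet w.1 v.1).ncard)
    (fun _ _ _ _ hw hv => edgeSet_ncard_eq hw hv)

/-- Isomorphism of directed multigraphs. -/
def MultiDigraph.IsIso (G H : MultiDigraph) : Prop :=
  ∃ f : G.V ≃ H.V, ∀ p q, H.edges (f p) (f q) = G.edges p q

/-- The double-edged path with `m` vertices `0, …, m - 1`. For `m ≥ 2` there is one edge in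
each direction between consecutive vertices, except that there are two edges from `m - 1`
to `m - 2`; for `m = 1` (the degenerate form) there are two loops at the only vertex. -/
def doubleEdgedPath (m : ℕ) : MultiDigraph where
  V := Fin m
  edges i j :=
    if m = 1 then 2
    else if (i : ℕ) + 1 = j then 1
    else if (j : ℕ) + 1 = i then (if (i : ℕ) + 1 = m then 2 else 1)
    else 0

/-- A graph is of type (P3) if it is a double-edged path with at least one vertex. -/
def IsTypeP3 (G : MultiDigraph) : Prop := ∃ m : ℕ, 1 ≤ m ∧ G.IsIso (doubleEdgedPath m)

end AutConj

/-!
The word length has the parity of the sum of the two exponent sums, and this parity is the same for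
all minimal words of `W`. Modulo `Inn`, a one-letter automorphism is `τ^±1` with `τ : a ↦ ab`,
`b ↦ b`, possibly conjugated by the exchange of `a` and `b`; as it has to preserve the odd length,
the parities of the exponent sums of `w` decide whether the exchange occurs. So two different edges
from `[w]` to `[v]` are, up to the exchange, `τ` and `τ⁻¹`, and `τ w ∼_J τ⁻¹ w`. The exponent sums
show that the letter permutation involved is the identity or `a ↦ a⁻¹`, `b ↦ b`.

* In the first case `τ² w` is conjugate to `w`. Unless `w` is conjugate to a power of `b`, it is a
  cyclic word `a^ε₁ b^k₁ ⋯ a^εₙ b^kₙ`, and `τ^m` adds `m (εᵢ + εᵢ₊₁) / 2` to `kᵢ`. All powers of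
  `τ²` give rotations of the same word, which bounds the exponents, so each `εᵢ + εᵢ₊₁` vanishes
  and `τ` fixes the cyclic word.
* In the second case let `ι : a ↦ a⁻¹`, `b ↦ b`. Modulo `Inn`, `τ ι τ = ι`, so `w` is conjugate to
  `ι w`. If a rotation acts on a word of odd length as an involution of the alphabet, that
  involution fixes all letters of the word; hence `w` is conjugate to a power of `b`.

Either way `τ w` is conjugate to `w`, so a double edge is a loop. A graph of type (P3) with at least
two vertices has a double edge that is not a loop.
-/

namespace AutConj

open FreeGroup List

theorem map_eq_self_of_isRotated {β : Type*} {f : β → β} (hf : Function.Involutive f) {L : List β}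
    (hL : Odd L.length) (h : L ~r L.map f) : L.map f = L := by
  obtain ⟨s, hs⟩ := h
  have hrot (n : ℕ) : L.rotate (n * s) = L.map f^[n] := by
    induction n with
    | zero => simp
    | succ n ih =>
      rw [Nat.succ_mul, ← rotate_rotate, ih, ← map_rotate, hs, map_map, Function.iterate_succ]
  rw [← hf.iterate_odd hL, ← hrot, rotate_length_mul]

section ReducedWords

variable {α : Type*} {L M : List (α × Bool)}

theorem isCyclicallyReduced_cons_iff {x : α × Bool} :
    IsCyclicallyReduced (x :: L) ↔ IsReduced (x :: L ++ [x]) := by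
  rw [isCyclicallyReduced_iff, FreeGroup.IsReduced, FreeGroup.IsReduced, isChain_append]
  simp

theorem isCyclicallyReduced_iff_cycle_chain : IsCyclicallyReduced L ↔
    Cycle.Chain (fun x y : α × Bool => x.1 = y.1 → x.2 = y.2) (L : Cycle (α × Bool)) := by
  cases L with
  | nil => simp
  | cons x L => rw [isCyclicallyReduced_cons_iff, Cycle.chain_coe_cons]; rfl

theorem isCyclicallyReduced_of_isRotated (hL : IsCyclicallyReduced L) (h : L ~r M) :
    IsCyclicallyReduced M := by
  rw [isCyclicallyReduced_iff_cycle_chain] at hL ⊢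
  rwa [← Cycle.coe_eq_coe.2 h]

theorem isConj_mk_of_isRotated (h : L ~r M) : IsConj (mk L) (mk M) := by
  obtain ⟨n, hn, rfl⟩ := isRotated_iff_mod.1 h
  rw [rotate_eq_drop_append_take hn, ← mul_mk]
  nth_rw 1 [← take_append_drop n L]
  rw [← mul_mk]
  exact isConj_iff.2 ⟨mk (drop n L), by group⟩

theorem eq_of_mk_eq_mk (hL : IsReduced L) (hM : IsReduced M) (h : mk L = mk M) : L = M := by
  classical rw [← hL.reduce_eq, ← hM.reduce_eq, reduce.sound h]

theorem isReduced_invRev (hL : IsReduced L) : IsReduced (invRev L) := by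
  classical rw [isReduced_iff_reduce_eq, reduce_invRev, hL.reduce_eq]

theorem exists_isCyclicallyReduced_isConj (g : FreeGroup α) :
    ∃ L : List (α × Bool), IsCyclicallyReduced L ∧ IsConj g (mk L) := by
  classical
  refine ⟨reduceCyclically g.toWord, reduceCyclically.isCyclicallyReduced isReduced_toWord,
    (isConj_iff.2 ⟨mk (reduceCyclically.conjugator g.toWord), ?_⟩).symm⟩
  rw [inv_mk, mul_mk, mul_mk, reduceCyclically.conj_conjugator_reduceCyclically, mk_toWord]

theorem not_isCyclicallyReduced_append_invRev {G : List (α × Bool)} (hG : G ≠ []) :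
    ¬ IsCyclicallyReduced (G ++ L ++ invRev G) := by
  obtain ⟨x, G, rfl⟩ := exists_cons_of_ne_nil hG
  intro h
  rw [cons_append, cons_append, isCyclicallyReduced_cons_iff] at h
  have hx : IsReduced [(x.1, !x.2), x] := h.infix ⟨x :: (G ++ L ++ invRev G), [], by simp [invRev]⟩
  simp [isReduced_cons_cons] at hx

theorem mk_cons (x : α × Bool) (L : List (α × Bool)) : mk (x :: L) = mk [x] * mk L := by simp

theorem isReduced_or_isRotated_conj_letter (hL : IsReduced L) (x : α × Bool) :
    IsReduced (x :: L ++ [(x.1, !x.2)]) ∨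
      ∃ M, L ~r M ∧ mk [x] * mk L * (mk [x])⁻¹ = mk M := by
  have hinv : mk [(x.1, !x.2)] = (mk [x])⁻¹ := by simp [invRev]
  rcases L with _ | ⟨y, L⟩
  · exact Or.inr ⟨[], IsRotated.refl _, by rw [← one_eq_mk, mul_one, mul_inv_cancel]⟩
  by_cases hy : y = (x.1, !x.2)
  · refine Or.inr ⟨L ++ [y], IsRotated.cons_append_singleton, ?_⟩
    rw [mk_cons y, ← mul_mk, hy, hinv, mul_inv_cancel_left]
  obtain ⟨N, z, hN⟩ : ∃ N z, y :: L = N ++ [z] :=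
    ⟨_, _, (dropLast_append_getLast (cons_ne_nil y L)).symm⟩
  by_cases hz : z = x
  · refine Or.inr ⟨x :: N, ?_, ?_⟩
    · rw [hN, hz]
      exact IsRotated.cons_append_singleton.symm
    · rw [hN, hz, ← mul_mk, mk_cons x N, mul_assoc, mul_inv_cancel_right]
  left
  have hfront : IsReduced ([x] ++ y :: L) := by
    refine isReduced_cons_cons.2 ⟨fun h => ?_, hL⟩
    by_contra hne
    exact hy (Prod.ext h.symm (Bool.eq_not.2 (Ne.symm hne)))
  have hback : IsReduced (y :: L ++ [(x.1, !x.2)]) := by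
    rw [FreeGroup.IsReduced, isChain_append, hN]
    refine ⟨hN ▸ hL, by simp, ?_⟩
    simp only [getLast?_concat, head?_cons, Option.mem_some_iff, forall_eq']
    exact fun h => Bool.eq_not.2 fun hne => hz (Prod.ext h hne)
  exact hfront.append_overlap hback (cons_ne_nil y L)

theorem isRotated_of_isConj (hL : IsCyclicallyReduced L) (hM : IsCyclicallyReduced M)
    (h : IsConj (mk L) (mk M)) : L ~r M := by
  classical
  obtain ⟨g, hg⟩ := isConj_iff.1 h
  obtain ⟨G, hG, rfl⟩ : ∃ G, IsReduced G ∧ mk G = g := ⟨_, isReduced_toWord, mk_toWord⟩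
  clear h
  induction G using reverseRecOn generalizing L with
  | nil =>
    rw [← one_eq_mk, one_mul, inv_one, mul_one] at hg
    rw [eq_of_mk_eq_mk hL.isReduced hM.isReduced hg]
  | append_singleton G x ih =>
    rcases isReduced_or_isRotated_conj_letter hL.isReduced x with hred | ⟨L', hrot, hL'⟩
    · exfalso
      have hLnil : L ≠ [] := by
        rintro rfl
        simp [isReduced_cons_cons] at hred
      have hfront : IsReduced ((G ++ [x]) ++ L) := by
        have hxL : IsReduced ([x] ++ L) := hred.infix ⟨[], [(x.1, !x.2)], by simp⟩
        exact hG.append_overlap hxL (by simp)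
      have hback : IsReduced (L ++ invRev (G ++ [x])) := by
        have hLx : IsReduced (L ++ [(x.1, !x.2)]) := hred.infix ⟨[x], [], by simp⟩
        have hinv : invRev (G ++ [x]) = [(x.1, !x.2)] ++ invRev G := by simp [invRev]
        rw [hinv, ← append_assoc]
        exact hLx.append_overlap (hinv ▸ isReduced_invRev hG) (by simp)
      have hword : G ++ [x] ++ L ++ invRev (G ++ [x]) = M := by
        refine eq_of_mk_eq_mk (hfront.append_overlap hback hLnil) hM.isReduced ?_
        rw [← hg, inv_mk, mul_mk, mul_mk]
      exact not_isCyclicallyReduced_append_invRev (by simp) (hword ▸ hM)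
    · refine hrot.trans (ih (isCyclicallyReduced_of_isRotated hL hrot)
        (hG.infix ⟨[], [x], by simp⟩) ?_)
      rw [← hL', ← hg, ← mul_mk]
      group

end ReducedWords

/-- The sum of the exponents of the `i`-th generator in `w`. -/
def exponentSum (i : Fin 2) (w : F2) : ℤ :=
  (lift (fun j => Multiplicative.ofAdd (if j = i then (1 : ℤ) else 0)) w).toAdd

@[simp] theorem exponentSum_one (i : Fin 2) : exponentSum i 1 = 0 := by simp [exponentSum]

@[simp] theorem exponentSum_mul (i : Fin 2) (w v : F2) :
    exponentSum i (w * v) = exponentSum i w + exponentSum i v := by simp [exponentSum]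

@[simp] theorem exponentSum_inv (i : Fin 2) (w : F2) :
    exponentSum i w⁻¹ = -exponentSum i w := by simp [exponentSum]

@[simp] theorem exponentSum_a (i : Fin 2) : exponentSum i a = if 0 = i then 1 else 0 := by
  simp [exponentSum, a]

@[simp] theorem exponentSum_b (i : Fin 2) : exponentSum i b = if 1 = i then 1 else 0 := by
  simp [exponentSum, b]

theorem exponentSum_eq_of_isConj {w v : F2} (h : IsConj w v) (i : Fin 2) :
    exponentSum i w = exponentSum i v := by
  obtain ⟨u, rfl⟩ := isConj_iff.1 h
  simp

theorem exponentSum_map (φ : MulAut F2) (i : Fin 2) (w : F2) :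
    exponentSum i (φ w) =
      exponentSum 0 w * exponentSum i (φ a) + exponentSum 1 w * exponentSum i (φ b) := by
  induction w using FreeGroup.induction_on with
  | C1 => simp
  | of j => fin_cases j <;> simp [← a.eq_1, ← b.eq_1]
  | inv_of j ih => simp only [_root_.map_inv, exponentSum_inv, ih]; ring
  | mul x y ihx ihy => simp only [_root_.map_mul, exponentSum_mul, ihx, ihy]; ring

theorem odd_length_iff (L : List (Fin 2 × Bool)) :
    Odd L.length ↔ Odd (exponentSum 0 (mk L) + exponentSum 1 (mk L)) := by
  induction L with
  | nil => simp [← one_eq_mk]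
  | cons x L ih =>
    have hletter : Odd (exponentSum 0 (mk [x]) + exponentSum 1 (mk [x])) := by
      obtain ⟨i, e⟩ := x
      fin_cases i <;> cases e <;> simp [exponentSum]
    rw [mk_cons, exponentSum_mul, exponentSum_mul, add_add_add_comm, Int.odd_add,
      iff_true_left hletter, ← Int.not_odd_iff_even, ← ih, length_cons, Nat.odd_add_one]

theorem odd_norm_iff (w : F2) : Odd w.norm ↔ Odd (exponentSum 0 w + exponentSum 1 w) := by
  rw [FreeGroup.norm, odd_length_iff, mk_toWord]

theorem mulAut_ext {φ ψ : MulAut F2} (ha : φ a = ψ a) (hb : φ b = ψ b) : φ = ψ := by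
  have h : φ.toMonoidHom = ψ.toMonoidHom := by
    ext i
    fin_cases i
    exacts [ha, hb]
  exact MulEquiv.toMonoidHom_injective h

theorem coe_eq_coe_of_conj {φ ψ : MulAut F2} (u : F2) (ha : φ a = u * ψ a * u⁻¹)
    (hb : φ b = u * ψ b * u⁻¹) : (φ : MulAut F2 ⧸ Inn) = ψ := by
  have h : φ = MulAut.conj u * ψ := mulAut_ext (by simp [ha]) (by simp [hb])
  rw [h, QuotientGroup.mk_mul, (QuotientGroup.eq_one_iff (N := Inn) _).2 ⟨u, rfl⟩, one_mul]

theorem isConj_of_coe_eq_coe {φ ψ : MulAut F2} (h : (φ : MulAut F2 ⧸ Inn) = ψ) (w : F2) :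
    IsConj (φ w) (ψ w) := by
  obtain ⟨u, hu⟩ := QuotientGroup.eq.1 h
  refine isConj_iff.2 ⟨φ u, ?_⟩
  rw [← mul_inv_cancel_left φ ψ, ← hu]
  simp

theorem IsPermutation.one : IsPermutation 1 := by simp [IsPermutation]

theorem IsPermutation.mul {σ τ : MulAut F2} (hσ : IsPermutation σ) (hτ : IsPermutation τ) :
    IsPermutation (σ * τ) := by
  rw [IsPermutation, MulAut.coe_mul, Set.image_comp, hτ, hσ]

theorem IsPermutation.cases {σ : MulAut F2} (h : IsPermutation σ) :
    ((σ a = a ∨ σ a = a⁻¹) ∧ (σ b = b ∨ σ b = b⁻¹)) ∨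
    ((σ a = b ∨ σ a = b⁻¹) ∧ (σ b = a ∨ σ b = a⁻¹)) := by
  have ha : σ a ∈ letters := h ▸ Set.mem_image_of_mem _ (Or.inl rfl)
  have hb : σ b ∈ letters := h ▸ Set.mem_image_of_mem _ (Or.inr (Or.inl rfl))
  have hab : a ≠ b := by simp [a, b, of_injective.eq_iff]
  have hab' : a ≠ b⁻¹ := fun h => by simpa using congrArg (exponentSum 0) h
  have h1 : σ a ≠ σ b := σ.injective.ne hab
  have h2 : σ a ≠ (σ b)⁻¹ := by rw [← _root_.map_inv]; exact σ.injective.ne hab'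
  simp only [letters, Set.mem_insert_iff, Set.mem_singleton_iff] at ha hb
  rcases ha with e | e | e | e <;> rcases hb with e' | e' | e' | e' <;>
    simp [e, e'] at h1 h2 ⊢

theorem JEquiv.of_isConj {w v : F2} (h : IsConj w v) : JEquiv w v := by
  obtain ⟨u, hu⟩ := isConj_iff.1 h
  exact ⟨MulAut.conj u, Subgroup.subset_closure (Or.inl ⟨u, rfl⟩), hu⟩

theorem JEquiv.of_isPermutation {σ : MulAut F2} (hσ : IsPermutation σ) (w : F2) :
    JEquiv w (σ w) :=
  ⟨σ, Subgroup.subset_closure (Or.inr hσ), rfl⟩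

theorem exists_isPermutation_coe_eq {g : MulAut F2} (hg : g ∈ J) :
    ∃ σ : MulAut F2, IsPermutation σ ∧ (g : MulAut F2 ⧸ Inn) = σ := by
  induction hg using Subgroup.closure_induction with
  | mem g hg =>
    rcases hg with hg | hg
    · exact ⟨1, .one, (QuotientGroup.eq_one_iff g).2 hg⟩
    · exact ⟨g, hg, rfl⟩
  | one => exact ⟨1, .one, rfl⟩
  | inv g _ ih =>
    obtain ⟨σ, hσ, h⟩ := ih
    exact ⟨σ⁻¹, hσ.inv, by rw [QuotientGroup.mk_inv, h, QuotientGroup.mk_inv]⟩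
  | mul g h _ _ ihg ihh =>
    obtain ⟨σ, hσ, hg⟩ := ihg
    obtain ⟨τ, hτ, hh⟩ := ihh
    exact ⟨σ * τ, hσ.mul hτ, by rw [QuotientGroup.mk_mul, hg, hh, QuotientGroup.mk_mul]⟩

theorem JEquiv.exists_isConj {w v : F2} (h : JEquiv w v) :
    ∃ σ : MulAut F2, IsPermutation σ ∧ IsConj (σ w) v := by
  obtain ⟨g, hg, rfl⟩ := h
  obtain ⟨σ, hσ, hgσ⟩ := exists_isPermutation_coe_eq hg
  exact ⟨σ, hσ, isConj_of_coe_eq_coe hgσ.symm w⟩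

theorem JEquiv.odd_norm_iff {w v : F2} (h : JEquiv w v) : Odd w.norm ↔ Odd v.norm := by
  obtain ⟨σ, hσ, hc⟩ := h.exists_isConj
  simp only [AutConj.odd_norm_iff, ← exponentSum_eq_of_isConj hc, exponentSum_map σ _ w]
  rcases hσ.cases with ⟨ha | ha, hb | hb⟩ | ⟨ha | ha, hb | hb⟩ <;>
    simp [ha, hb, Int.odd_iff] <;> omega

/-- The automorphism `a ↦ ab`, `b ↦ b`. -/
def twist : MulAut F2 :=
  MonoidHom.toMulEquiv (lift ![a * b, b]) (lift ![a * b⁻¹, b])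
    (by ext i; fin_cases i <;> simp [a, b]) (by ext i; fin_cases i <;> simp [a, b])

@[simp] theorem twist_a : twist a = a * b := by simp [twist, a]

@[simp] theorem twist_b : twist b = b := by simp [twist, b]

@[simp] theorem twist_symm_a : twist.symm a = a * b⁻¹ := by simp [MulEquiv.symm_apply_eq]

@[simp] theorem twist_symm_b : twist.symm b = b := by simp [MulEquiv.symm_apply_eq]

@[simp] theorem twist_zpow_b (n : ℤ) : (twist ^ n) b = b :=
  (MulAction.stabilizer (MulAut F2) b).zpow_mem twist_b n

@[simp] theorem twist_zpow_a (n : ℤ) : (twist ^ n) a = a * b ^ n := by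
  have hone (n : ℤ) : (twist ^ (n + 1)) a = (twist ^ n) a * b := by
    rw [zpow_add_one, MulAut.mul_apply, twist_a, _root_.map_mul, twist_zpow_b]
  induction n using Int.induction_on with
  | zero => simp
  | succ n ih => rw [hone, ih, zpow_add_one, mul_assoc]
  | pred n ih =>
    rw [← mul_left_inj b, ← hone, sub_add_cancel, ih, mul_assoc, ← zpow_add_one, sub_add_cancel]

/-- The automorphism `a ↦ a⁻¹`, `b ↦ b`. -/
def flipA : MulAut F2 :=
  MonoidHom.toMulEquiv (lift ![a⁻¹, b]) (lift ![a⁻¹, b])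
    (by ext i; fin_cases i <;> simp [a, b]) (by ext i; fin_cases i <;> simp [a, b])

@[simp] theorem flipA_a : flipA a = a⁻¹ := by simp [flipA, a]

@[simp] theorem flipA_b : flipA b = b := by simp [flipA, b]

/-- The automorphism exchanging `a` and `b`. -/
def swapAB : MulAut F2 := freeGroupCongr (Equiv.swap 0 1)

@[simp] theorem swapAB_a : swapAB a = b := by simp [swapAB, a, b]

@[simp] theorem swapAB_b : swapAB b = a := by simp [swapAB, a, b]

theorem isPermutation_swapAB : IsPermutation swapAB := by
  ext x
  simp [letters, Set.image_insert_eq, or_comm, or_left_comm]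

theorem swapAB_inv : swapAB⁻¹ = swapAB := inv_eq_of_mul_eq_one_left (mulAut_ext (by simp) (by simp))

theorem coe_twist_mul_flipA_mul_twist :
    ((twist * flipA * twist : MulAut F2) : MulAut F2 ⧸ Inn) = flipA :=
  coe_eq_coe_of_conj b⁻¹ (by simp) (by simp)

/-- The part `a ^ (±1) * b ^ exp` of a cyclic word, running from one letter `a ^ (±1)` up to the
next one. The signs of these two letters are `src` and `tgt`, with `true` for exponent `1`, as in
`FreeGroup`. A cyclic word containing the generator `a` is thought of as a closed path of
corners. -/
structure Corner where
  src : Bool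
  exp : ℤ
  tgt : Bool

namespace Corner

/-- The letters of a corner, without the final letter `a ^ (±1)`, which belongs to the next one. -/
def word (c : Corner) : List (Fin 2 × Bool) :=
  (0, c.src) :: replicate c.exp.natAbs (1, decide (0 ≤ c.exp))

/-- No cancellation takes place in the corner, including its final letter `a ^ (±1)`. -/
def IsReduced (c : Corner) : Prop := c.exp = 0 → c.src = c.tgt

/-- The amount by which `twist` changes the exponent of a corner: `a ↦ a * b` adds `1` on
the right of each `a`, and `a⁻¹ ↦ b⁻¹ * a⁻¹` subtracts `1` on the left of each `a⁻¹`. -/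
def turn (c : Corner) : ℤ := c.src.toInt + c.tgt.toInt - 1

/-- The effect of `twist ^ n` on a corner of a cyclic word. -/
def shift (n : ℤ) (c : Corner) : Corner := ⟨c.src, c.exp + n * c.turn, c.tgt⟩

theorem mk_word (c : Corner) : FreeGroup.mk c.word = FreeGroup.mk [(0, c.src)] * b ^ c.exp := by
  have hpow (e : Bool) (n : ℕ) :
      FreeGroup.mk (replicate n ((1 : Fin 2), e)) = FreeGroup.mk [(1, e)] ^ n := by
    rw [pow_mk, flatten_replicate_singleton]
  have hinv : FreeGroup.mk [((1 : Fin 2), false)] = b⁻¹ := by simp [b, of, invRev]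
  rw [word, mk_cons, hpow]
  congr 1
  rcases le_or_gt 0 c.exp with h | h
  · rw [decide_eq_true h, ← zpow_natCast, Int.natAbs_of_nonneg h]
    rfl
  · rw [decide_eq_false h.not_ge, hinv, inv_pow, ← zpow_natCast, ← zpow_neg,
      Int.ofNat_natAbs_of_nonpos h.le, neg_neg]

theorem IsReduced.isReduced_word {c : Corner} (hc : c.IsReduced) :
    FreeGroup.IsReduced (c.word ++ [(0, c.tgt)]) := by
  rw [word]
  rcases h : c.exp.natAbs with _ | n
  · simpa using hc (Int.natAbs_eq_zero.1 h)
  · have hchain : FreeGroup.IsReduced (replicate (n + 1) ((1 : Fin 2), decide (0 ≤ c.exp))) :=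
      isChain_replicate_of_rel _ fun _ => rfl
    rw [FreeGroup.IsReduced, cons_append, isChain_cons, isChain_append]
    refine ⟨?_, hchain, ?_, ?_⟩ <;> simp [head?_replicate, getLast?_replicate]

theorem IsReduced.shift {c : Corner} (hc : c.IsReduced) (n : ℤ) : (c.shift n).IsReduced := by
  obtain ⟨src, exp, tgt⟩ := c
  cases src <;> cases tgt <;> simp_all [IsReduced, Corner.shift, turn]

theorem shift_eq_self {c : Corner} (hc : c.turn = 0) (n : ℤ) : c.shift n = c := by
  rw [shift, hc, mul_zero, add_zero]

theorem twist_zpow_mk_letter (n : ℤ) (e : Bool) : (twist ^ n) (FreeGroup.mk [(0, e)]) =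
    b ^ (n * (e.toInt - 1)) * FreeGroup.mk [(0, e)] * b ^ (n * e.toInt) := by
  have htrue : FreeGroup.mk [((0 : Fin 2), true)] = a := rfl
  have hfalse : FreeGroup.mk [((0 : Fin 2), false)] = a⁻¹ := by simp [a, of, invRev]
  cases e <;> simp [htrue, hfalse]

theorem twist_zpow_mk_word (c : Corner) (n : ℤ) : (twist ^ n) (FreeGroup.mk c.word) =
    b ^ (n * (c.src.toInt - 1)) * FreeGroup.mk (c.shift n).word *
      (b ^ (n * (c.tgt.toInt - 1)))⁻¹ := by
  simp only [mk_word, shift, turn, _root_.map_mul, map_zpow, twist_zpow_b, twist_zpow_mk_letter]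
  group

end Corner

/-- The corners in the list have no cancellation, and each of them ends with the letter that the
next one starts with; the first letter of the path has sign `e`, and the last one sign `z`. -/
inductive IsReducedPath : Bool → List Corner → Bool → Prop
  | nil (e : Bool) : IsReducedPath e [] e
  | cons {c : Corner} {l : List Corner} {z : Bool} (hc : c.IsReduced)
      (hl : IsReducedPath c.tgt l z) : IsReducedPath c.src (c :: l) z

namespace IsReducedPath

variable {e z : Bool} {l : List Corner}

theorem shift (h : IsReducedPath e l z) (n : ℤ) : IsReducedPath e (l.map (Corner.shift n)) z := by
  induction h with
  | nil e => exact nil e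
  | cons hc _ ih => exact cons (hc.shift n) ih

theorem twist_zpow_mk (h : IsReducedPath e l z) (n : ℤ) :
    (twist ^ n) (mk (l.flatMap Corner.word)) = b ^ (n * (e.toInt - 1)) *
      mk ((l.map (Corner.shift n)).flatMap Corner.word) * (b ^ (n * (z.toInt - 1)))⁻¹ := by
  induction h with
  | nil e => simp [← one_eq_mk]
  | @cons c l z hc _ ih =>
    rw [map_cons, flatMap_cons, flatMap_cons, ← mul_mk, ← mul_mk, _root_.map_mul, ih,
      c.twist_zpow_mk_word]
    group

theorem exists_flatMap_word_append_eq_cons (h : IsReducedPath e l z) :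
    ∃ L, l.flatMap Corner.word ++ [(0, z)] = (0, e) :: L := by
  cases h with
  | nil => exact ⟨[], rfl⟩
  | cons => exact ⟨_, rfl⟩

theorem isReduced (h : IsReducedPath e l z) :
    IsReduced (l.flatMap Corner.word ++ [(0, z)]) := by
  induction h with
  | nil => exact IsReduced.singleton
  | @cons c l z hc hl ih =>
    obtain ⟨L, hL⟩ := hl.exists_flatMap_word_append_eq_cons
    rw [flatMap_cons, append_assoc, hL]
    rw [hL] at ih
    simpa using hc.isReduced_word.append_overlap (L₂ := [(0, c.tgt)]) ih (by simp)

theorem isCyclicallyReduced (h : IsReducedPath e l e) :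
    IsCyclicallyReduced (l.flatMap Corner.word) := by
  have hred := h.isReduced
  cases h with
  | nil => exact IsCyclicallyReduced.nil
  | cons => exact isCyclicallyReduced_cons_iff.2 hred

theorem isConj_twist_zpow_mk (h : IsReducedPath e l e) (n : ℤ) :
    IsConj ((twist ^ n) (mk (l.flatMap Corner.word)))
      (mk ((l.map (Corner.shift n)).flatMap Corner.word)) :=
  (isConj_iff.2 ⟨_, (h.twist_zpow_mk n).symm⟩).symm

theorem natAbs_exp_le_length {c : Corner} (hc : c ∈ l) :
    c.exp.natAbs ≤ (l.flatMap Corner.word).length := by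
  have hword : c.word.length ≤ (l.flatMap Corner.word).length :=
    (sublist_flatten_of_mem (mem_map_of_mem hc)).length_le
  rw [Corner.word, length_cons, length_replicate] at hword
  lia

end IsReducedPath

theorem exists_mk_eq_zpow {L : List (Fin 2 × Bool)} (hL : ∀ x ∈ L, x.1 = 1) :
    ∃ k : ℤ, mk L = b ^ k := by
  induction L with
  | nil => exact ⟨0, rfl⟩
  | cons x L ih =>
    obtain ⟨k, hk⟩ := ih fun y hy => hL y (mem_cons_of_mem _ hy)
    obtain ⟨i, e⟩ := x
    obtain rfl : i = 1 := hL _ mem_cons_self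
    rw [mk_cons, hk]
    cases e
    · exact ⟨-1 + k, by rw [zpow_add, zpow_neg_one]; rfl⟩
    · exact ⟨1 + k, by rw [zpow_add, zpow_one]; rfl⟩

theorem exists_corner {B : List (Fin 2 × Bool)} {e f : Bool} (hB : ∀ x ∈ B, x.1 = 1)
    (h : IsReduced ((0, e) :: B ++ [(0, f)])) :
    ∃ c : Corner, c.src = e ∧ c.tgt = f ∧ c.IsReduced ∧ mk c.word = mk ((0, e) :: B) := by
  obtain ⟨k, hk⟩ := exists_mk_eq_zpow hB
  refine ⟨⟨e, k, f⟩, rfl, rfl, fun hk0 => ?_, by rw [Corner.mk_word, mk_cons _ B, hk]⟩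
  obtain rfl : k = 0 := hk0
  have hBred : IsReduced B := h.infix ⟨[(0, e)], [(0, f)], by simp⟩
  obtain rfl : B = [] := eq_of_mk_eq_mk hBred IsReduced.nil hk
  simpa using h

/-- `B` is the part of the first corner that has already been read, for the induction on `M`. -/
theorem exists_isReducedPath {M B : List (Fin 2 × Bool)} {e z : Bool} (hB : ∀ x ∈ B, x.1 = 1)
    (h : IsReduced ((0, e) :: (B ++ M) ++ [(0, z)])) :
    ∃ l, IsReducedPath e l z ∧ mk (l.flatMap Corner.word) = mk ((0, e) :: (B ++ M)) := by
  induction M generalizing B e with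
  | nil =>
    rw [append_nil] at h ⊢
    obtain ⟨c, rfl, rfl, hc, hword⟩ := exists_corner hB h
    exact ⟨[c], .cons hc (.nil _), by rw [flatMap_singleton, hword]⟩
  | cons x M ih =>
    obtain ⟨i, f⟩ := x
    by_cases hi : i = 1
    · rw [append_cons B] at h ⊢
      refine ih (fun y hy => ?_) h
      rcases mem_append.1 hy with hy | hy
      · exact hB y hy
      · rwa [mem_singleton.1 hy]
    · obtain rfl : i = 0 := by lia
      have hcorner : IsReduced ((0, e) :: B ++ [(0, f)]) := h.infix ⟨[], M ++ [(0, z)], by simp⟩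
      have hrest : IsReduced ((0, f) :: ([] ++ M) ++ [(0, z)]) :=
        h.infix ⟨(0, e) :: B, [], by simp⟩
      obtain ⟨c, rfl, rfl, hc, hword⟩ := exists_corner hB hcorner
      obtain ⟨l, hl, hlword⟩ := ih (B := []) (by simp) hrest
      exact ⟨c :: l, .cons hc hl, by rw [flatMap_cons, ← mul_mk, hword, hlword]; simp⟩

theorem isConj_zpow_or_isReducedPath (w : F2) : (∃ k : ℤ, IsConj w (b ^ k)) ∨
    ∃ e l, IsReducedPath e l e ∧ IsConj w (mk (l.flatMap Corner.word)) := by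
  obtain ⟨L, hL, hw⟩ := exists_isCyclicallyReduced_isConj w
  by_cases hb : ∀ x ∈ L, x.1 = 1
  · obtain ⟨k, hk⟩ := exists_mk_eq_zpow hb
    exact Or.inl ⟨k, hk ▸ hw⟩
  right
  push Not at hb
  obtain ⟨⟨i, e⟩, hx, hi⟩ := hb
  obtain rfl : i = 0 := by lia
  obtain ⟨N, M, rfl⟩ := append_of_mem hx
  have hrot : N ++ (0, e) :: M ~r (0, e) :: (M ++ N) := isRotated_append
  have hred := isCyclicallyReduced_cons_iff.1 (isCyclicallyReduced_of_isRotated hL hrot)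
  obtain ⟨l, hl, hlword⟩ := exists_isReducedPath (B := []) (by simp) hred
  exact ⟨e, l, hl, hw.trans (hlword ▸ isConj_mk_of_isRotated hrot)⟩

/-- Otherwise the exponent of `c` would grow without bound under the powers of `twist ^ m`. -/
theorem IsReducedPath.turn_eq_zero {e : Bool} {l : List Corner} {m : ℤ} (h : IsReducedPath e l e)
    (hm : m ≠ 0) (hconj : ∀ n : ℕ, IsConj ((twist ^ (m * n)) (mk (l.flatMap Corner.word)))
      (mk (l.flatMap Corner.word))) {c : Corner} (hc : c ∈ l) : c.turn = 0 := by
  set N := (l.flatMap Corner.word).length with hN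
  have hbound (n : ℕ) : (c.exp + m * n * c.turn).natAbs ≤ N := by
    have hrot := isRotated_of_isConj (h.shift (m * n)).isCyclicallyReduced h.isCyclicallyReduced
      ((h.isConj_twist_zpow_mk _).symm.trans (hconj n))
    rw [hN, ← hrot.perm.length_eq]
    exact natAbs_exp_le_length (mem_map_of_mem (f := Corner.shift (m * n)) hc)
  by_contra ht
  have hgrow (n : ℕ) : n ≤ (m * n * c.turn).natAbs := by
    rw [mul_right_comm, Int.natAbs_mul, Int.natAbs_natCast]
    exact Nat.le_mul_of_pos_left n (Int.natAbs_pos.2 (mul_ne_zero hm ht))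
  have hle := hbound (N + c.exp.natAbs + 1)
  have hge := hgrow (N + c.exp.natAbs + 1)
  lia

theorem isConj_map (φ : MulAut F2) {w v : F2} (h : IsConj w v) : IsConj (φ w) (φ v) :=
  φ.toMonoidHom.map_isConj h

theorem isConj_twist_of_isConj_zpow {w : F2} {k : ℤ} (h : IsConj w (b ^ k)) :
    IsConj (twist w) w := by
  have htw := isConj_map twist h
  rw [map_zpow, twist_b] at htw
  exact htw.trans h.symm

theorem isConj_twist_of_isConj_twist_zpow {w : F2} {m : ℤ} (hm : m ≠ 0)
    (h : IsConj ((twist ^ m) w) w) : IsConj (twist w) w := by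
  have hiter (n : ℕ) : IsConj ((twist ^ (m * n)) w) w := by
    induction n with
    | zero => rw [Nat.cast_zero, mul_zero, zpow_zero, MulAut.one_apply]
    | succ n ih =>
      rw [Nat.cast_add_one, mul_add_one, zpow_add, MulAut.mul_apply]
      exact (isConj_map _ h).trans ih
  rcases isConj_zpow_or_isReducedPath w with ⟨k, hk⟩ | ⟨e, l, hl, hw⟩
  · exact isConj_twist_of_isConj_zpow hk
  · have hturn : ∀ c ∈ l, c.turn = 0 := fun c hc =>
      hl.turn_eq_zero hm (fun n => (isConj_map _ hw.symm).trans ((hiter n).trans hw)) hc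
    have hfix : l.map (Corner.shift 1) = l :=
      (map_congr_left fun c hc => c.shift_eq_self (hturn c hc) 1).trans (map_id l)
    have htw := hl.isConj_twist_zpow_mk 1
    rw [hfix, zpow_one] at htw
    exact (isConj_map twist hw).trans (htw.trans hw.symm)

/-- The effect of `flipA` on letters. -/
def flipLetter (x : Fin 2 × Bool) : Fin 2 × Bool := (x.1, if x.1 = 0 then !x.2 else x.2)

theorem flipLetter_involutive : Function.Involutive flipLetter := by
  unfold Function.Involutive
  decide

theorem flipA_mk (L : List (Fin 2 × Bool)) : flipA (mk L) = mk (L.map flipLetter) := by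
  induction L with
  | nil => exact _root_.map_one flipA
  | cons x L ih =>
    have hletter : flipA (mk [x]) = mk [flipLetter x] := by
      obtain ⟨i, e⟩ := x
      fin_cases i <;> cases e <;> rfl
    rw [map_cons, mk_cons, mk_cons (flipLetter x), _root_.map_mul, hletter, ih]

theorem isCyclicallyReduced_map_flipLetter {L : List (Fin 2 × Bool)}
    (hL : IsCyclicallyReduced L) : IsCyclicallyReduced (L.map flipLetter) := by
  rw [isCyclicallyReduced_iff_cycle_chain] at hL ⊢
  rw [← Cycle.map_coe, Cycle.chain_map]
  exact hL.imp (by decide)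

theorem isConj_zpow_of_isConj_flipA {w : F2} (hw : Odd w.norm) (h : IsConj (flipA w) w) :
    ∃ k : ℤ, IsConj w (b ^ k) := by
  obtain ⟨L, hL, hwL⟩ := exists_isCyclicallyReduced_isConj w
  have hodd : Odd L.length := by
    rw [odd_length_iff, ← exponentSum_eq_of_isConj hwL, ← exponentSum_eq_of_isConj hwL,
      ← odd_norm_iff]
    exact hw
  have hflip : IsConj (mk L) (mk (L.map flipLetter)) := by
    rw [← flipA_mk]
    exact hwL.symm.trans (h.symm.trans (isConj_map flipA hwL))
  have hfix : L.map flipLetter = L := map_eq_self_of_isRotated flipLetter_involutive hodd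
    (isRotated_of_isConj hL (isCyclicallyReduced_map_flipLetter hL) hflip)
  have hb : ∀ x ∈ L, x.1 = 1 := by
    intro x hx
    have hx : flipLetter x = x := (map_eq_map_iff (g := id)).1 (by rwa [map_id]) x hx
    exact (by decide : ∀ x : Fin 2 × Bool, flipLetter x = x → x.1 = 1) x hx
  obtain ⟨k, hk⟩ := exists_mk_eq_zpow hb
  exact ⟨k, hk ▸ hwL⟩

theorem IsPermutation.eq_one_or_eq_flipA {σ : MulAut F2} (hσ : IsPermutation σ) {w : F2}
    (ha : Even (exponentSum 0 w)) (hb : Odd (exponentSum 1 w))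
    (h : IsConj (σ (twist w)) (twist⁻¹ w)) : σ = 1 ∨ σ = flipA := by
  have h0 := exponentSum_eq_of_isConj h 0
  have h1 := exponentSum_eq_of_isConj h 1
  rw [exponentSum_map σ, exponentSum_map twist 0 w, exponentSum_map twist 1 w,
    exponentSum_map twist⁻¹ _ w] at h0 h1
  rw [Int.even_iff] at ha
  rw [Int.odd_iff] at hb
  rcases hσ.cases with ⟨ea | ea, eb | eb⟩ | ⟨ea | ea, eb | eb⟩ <;> simp [ea, eb] at h0 h1
  · exact Or.inl (mulAut_ext (by simp [ea]) (by simp [eb]))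
  · lia
  · exact Or.inr (mulAut_ext (by simp [ea]) (by simp [eb]))
  all_goals lia

theorem jEquiv_twist_self_of_jEquiv_twist_inv {w : F2} (ha : Even (exponentSum 0 w))
    (hb : Odd (exponentSum 1 w)) (h : JEquiv (twist w) (twist⁻¹ w)) : JEquiv (twist w) w := by
  obtain ⟨σ, hσ, hconj⟩ := h.exists_isConj
  have htw := isConj_map twist hconj
  rw [MulAut.apply_inv_self] at htw
  apply JEquiv.of_isConj
  rcases hσ.eq_one_or_eq_flipA ha hb hconj with rfl | rfl
  · exact isConj_twist_of_isConj_twist_zpow two_ne_zero htw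
  · have hflip : IsConj (flipA w) w :=
      (isConj_of_coe_eq_coe coe_twist_mul_flipA_mul_twist w).symm.trans htw
    obtain ⟨k, hk⟩ := isConj_zpow_of_isConj_flipA ((odd_norm_iff w).2 (ha.add_odd hb)) hflip
    exact isConj_twist_of_isConj_zpow hk

theorem IsOneLetter.exists_coe_eq {φ : MulAut F2} (h : IsOneLetter φ) :
    ∃ π : MulAut F2, (π = 1 ∨ π = swapAB) ∧
      ∃ s : ℤˣ, (φ : MulAut F2 ⧸ Inn) = (π * twist ^ (s : ℤ) * π⁻¹ : MulAut F2) := by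
  obtain ⟨x, hx, y, hy, h1, h2, h3, h4⟩ := h
  rcases hx with rfl | rfl | rfl | rfl <;> rcases hy with rfl | rfl | rfl | rfl <;>
    simp only [ne_eq, not_true_eq_false, inv_inv, _root_.map_inv, inv_eq_iff_eq_inv, mul_inv_rev]
      at h1 h2 h3 h4
  · exact ⟨swapAB, .inr rfl, 1, coe_eq_coe_of_conj 1 (by simp [h3, swapAB_inv])
      (by simp [h4, swapAB_inv])⟩
  · exact ⟨swapAB, .inr rfl, -1, coe_eq_coe_of_conj a⁻¹ (by simp [h3, swapAB_inv])
      (by simp [h4, swapAB_inv, mul_assoc])⟩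
  · exact ⟨1, .inl rfl, 1, coe_eq_coe_of_conj 1 (by simp [h4]) (by simp [h3])⟩
  · exact ⟨1, .inl rfl, -1, coe_eq_coe_of_conj b⁻¹ (by simp [h4, mul_assoc]) (by simp [h3])⟩
  · exact ⟨swapAB, .inr rfl, -1, coe_eq_coe_of_conj 1 (by simp [h3, swapAB_inv])
      (by simp [h4, swapAB_inv])⟩
  · exact ⟨swapAB, .inr rfl, 1, coe_eq_coe_of_conj a (by simp [h3, swapAB_inv])
      (by simp [h4, swapAB_inv, mul_assoc])⟩
  · exact ⟨1, .inl rfl, -1, coe_eq_coe_of_conj 1 (by simp [h4]) (by simp [h3])⟩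
  · exact ⟨1, .inl rfl, 1, coe_eq_coe_of_conj b (by simp [h4, mul_assoc]) (by simp [h3])⟩

theorem IsPermutation.of_eq_one_or_eq_swapAB {π : MulAut F2} (h : π = 1 ∨ π = swapAB) :
    IsPermutation π := by
  rcases h with rfl | rfl
  exacts [.one, isPermutation_swapAB]

theorem exists_twist_of_mem_edgeSet {w v : F2} {c : MulAut F2 ⧸ Inn} (hc : c ∈ edgeSet w v) :
    ∃ π : MulAut F2, (π = 1 ∨ π = swapAB) ∧ ∃ s : ℤˣ,
      c = (π * twist ^ (s : ℤ) * π⁻¹ : MulAut F2) ∧ JEquiv ((twist ^ (s : ℤ)) (π⁻¹ w)) v := by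
  obtain ⟨φ, hφ, rfl, hφv⟩ := hc
  obtain ⟨π, hπ, s, hs⟩ := hφ.exists_coe_eq
  exact ⟨π, hπ, s, hs, (JEquiv.of_isPermutation (.of_eq_one_or_eq_swapAB hπ) _).trans
    ((JEquiv.of_isConj (isConj_of_coe_eq_coe hs w)).symm.trans hφv)⟩

theorem even_and_odd_of_jEquiv_twist_zpow {w v : F2} (hw : Odd w.norm) (hv : Odd v.norm) {s : ℤˣ}
    (h : JEquiv ((twist ^ (s : ℤ)) w) v) :
    Even (exponentSum 0 w) ∧ Odd (exponentSum 1 w) := by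
  have hs := h.odd_norm_iff.2 hv
  rw [odd_norm_iff, exponentSum_map _ 0 w, exponentSum_map _ 1 w] at hs
  rw [odd_norm_iff] at hw
  rw [Int.even_iff, Int.odd_iff]
  rw [Int.odd_iff] at hs hw
  rcases Int.units_eq_one_or s with rfl | rfl <;> simp at hs <;> lia

theorem exponentSum_zero_swapAB (w : F2) : exponentSum 0 (swapAB w) = exponentSum 1 w := by
  rw [exponentSum_map]
  simp

theorem eq_of_even_exponentSum {π ρ : MulAut F2} (hπ : π = 1 ∨ π = swapAB)
    (hρ : ρ = 1 ∨ ρ = swapAB) {w : F2} (hw : Odd w.norm) (hπw : Even (exponentSum 0 (π⁻¹ w)))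
    (hρw : Even (exponentSum 0 (ρ⁻¹ w))) : π = ρ := by
  have hsum : ¬Even (exponentSum 0 w + exponentSum 1 w) :=
    Int.not_even_iff_odd.2 ((odd_norm_iff w).1 hw)
  rcases hπ with rfl | rfl <;> rcases hρ with rfl | rfl
  · rfl
  · rw [swapAB_inv, exponentSum_zero_swapAB] at hρw
    exact absurd (hπw.add hρw) hsum
  · rw [swapAB_inv, exponentSum_zero_swapAB] at hπw
    exact absurd (hρw.add hπw) hsum
  · rfl

theorem jEquiv_of_two_edges {w v : F2} (hw : Odd w.norm) (hv : Odd v.norm)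
    {c d : MulAut F2 ⧸ Inn} (hc : c ∈ edgeSet w v) (hd : d ∈ edgeSet w v) (hcd : c ≠ d) :
    JEquiv w v := by
  obtain ⟨π, hπ, s, rfl, hs⟩ := exists_twist_of_mem_edgeSet hc
  obtain ⟨ρ, hρ, t, rfl, ht⟩ := exists_twist_of_mem_edgeSet hd
  have jEquiv_inv {τ : MulAut F2} (hτ : τ = 1 ∨ τ = swapAB) : JEquiv w (τ⁻¹ w) :=
    .of_isPermutation (IsPermutation.of_eq_one_or_eq_swapAB hτ).inv w
  obtain ⟨ha, hb⟩ := even_and_odd_of_jEquiv_twist_zpow ((jEquiv_inv hπ).odd_norm_iff.1 hw) hv hs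
  obtain ⟨ha', -⟩ := even_and_odd_of_jEquiv_twist_zpow ((jEquiv_inv hρ).odd_norm_iff.1 hw) hv ht
  obtain rfl := eq_of_even_exponentSum hπ hρ hw ha ha'
  obtain ⟨h₁, h₂⟩ : JEquiv (twist (π⁻¹ w)) v ∧ JEquiv (twist⁻¹ (π⁻¹ w)) v := by
    rcases Int.units_eq_one_or s with rfl | rfl <;> rcases Int.units_eq_one_or t with rfl | rfl
    · exact absurd rfl hcd
    · exact ⟨by simpa using hs, by simpa using ht⟩
    · exact ⟨by simpa using ht, by simpa using hs⟩
    · exact absurd rfl hcd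
  have hself := jEquiv_twist_self_of_jEquiv_twist_inv ha hb (h₁.trans h₂.symm)
  exact (jEquiv_inv hπ).trans (hself.symm.trans h₁)

theorem IsMinimal.norm_eq {w v : F2} (hw : IsMinimal w) (hv : IsMinimal v) (h : AutEquiv w v) :
    w.norm = v.norm := by
  obtain ⟨φ, rfl⟩ := h
  exact (hw φ).antisymm (by simpa using hv φ⁻¹)

theorem IsAutClass.autEquiv {W : Set F2} (hW : IsAutClass W) {w v : F2} (hw : w ∈ W)
    (hv : v ∈ W) : AutEquiv w v := by
  obtain ⟨u, rfl⟩ := hW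
  obtain ⟨φ, rfl⟩ := hw
  obtain ⟨ψ, rfl⟩ := hv
  exact ⟨ψ * φ⁻¹, by simp⟩

theorem eq_of_two_le_edges {W : Set F2} (hW : IsAutClass W)
    (hodd : ∃ w ∈ W, IsMinimal w ∧ Odd w.norm) {p q : (Γ W).V} (h : 2 ≤ (Γ W).edges p q) :
    p = q := by
  obtain ⟨w₀, hw₀, hmin₀, hodd₀⟩ := hodd
  have odd_norm (w : {w : F2 // w ∈ W ∧ IsMinimal w}) : Odd w.1.norm :=
    hmin₀.norm_eq w.2.2 (hW.autEquiv hw₀ w.2.1) ▸ hodd₀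
  induction p, q using Quotient.inductionOn₂ with
  | _ w v =>
    have hcard : 1 < (edgeSet w.1 v.1).ncard := h
    obtain ⟨c, hc, d, hd, hcd⟩ := (Set.one_lt_ncard (Set.finite_of_ncard_pos (by lia))).1 hcard
    exact Quotient.sound (jEquiv_of_two_edges (odd_norm w) (odd_norm v) hc hd hcd)

theorem IsTypeP3.card_eq_one_and_edges_eq_two {G : MultiDigraph} (hG : IsTypeP3 G)
    (hloop : ∀ p q, 2 ≤ G.edges p q → p = q) :
    Nat.card G.V = 1 ∧ ∀ v, G.edges v v = 2 := by
  obtain ⟨m, hm, f, hf⟩ := hG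
  obtain rfl | hm := hm.eq_or_lt
  · refine ⟨(Nat.card_congr f).trans (Nat.card_fin 1), fun v => ?_⟩
    simp [← hf, doubleEdgedPath]
  · let last : (doubleEdgedPath m).V := (⟨m - 1, by lia⟩ : Fin m)
    let penultimate : (doubleEdgedPath m).V := (⟨m - 2, by lia⟩ : Fin m)
    have hedges : G.edges (f.symm last) (f.symm penultimate) = 2 := by
      rw [← hf, f.apply_symm_apply, f.apply_symm_apply]
      simp only [doubleEdgedPath, last, penultimate]
      grind
    have heq : last = penultimate := f.symm.injective (hloop _ _ hedges.ge)
    have := congrArg Fin.val heq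
    simp only [last, penultimate] at this
    lia

end AutConj

theorem mainTheorem5_general (W : Set AutConj.F2) (hW : AutConj.IsAutClass W)
    (hodd : ∃ w ∈ W, AutConj.IsMinimal w ∧ Odd w.norm)
    (hP3 : AutConj.IsTypeP3 (AutConj.Γ W)) :
    Nat.card (AutConj.Γ W).V = 1 ∧ ∀ v : (AutConj.Γ W).V, (AutConj.Γ W).edges v v = 2 :=
  hP3.card_eq_one_and_edges_eq_two fun _ _ => AutConj.eq_of_two_le_edges hW hodd

theorem mainTheorem5 (W : Set AutConj.F2) (hW : AutConj.IsAutClass W)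
    (hroot : ¬ AutConj.IsRootClass W)
    (hodd : ∃ w ∈ W, AutConj.IsMinimal w ∧ Odd w.norm)
    (hP3 : AutConj.IsTypeP3 (AutConj.Γ W)) :
    Nat.card (AutConj.Γ W).V = 1 ∧ ∀ v : (AutConj.Γ W).V, (AutConj.Γ W).edges v v = 2 :=
  mainTheorem5_general W hW hodd hP3
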